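/- **Proposition (Approximation by a $0$-regular random zonotope).** Call a set $K\subset\mathbb{R}^2$ *symmetric convex* if it is nonempty, compact, convex and satisfies $K=\tfrac12(K\oplus(-K))$, where $\oplus$ is Minkowski addition. For such $K$ let $$H_K(\theta)=\sup_{s\in K}\langle u_\theta,s\rangle+\sup_{s\in -K}\langle u_\theta,s\rangle,\qquad u_\theta=(-\sin\theta,\cos\theta),$$ be its Feret diameter and $\operatorname{diam}(K)=\sup_{\theta\in\mathbb{R}}H_K(\theta)$; let $d_H$ be the Hausdorff distance. For an integer $N>1$ put $\theta_i=\frac{(i-1)\pi}{N}$ ($1\le i\le N$), let $S_\theta=\{s(\cos\theta,\sin\theta): |s|\le\frac12\}$, $F^{(N)}=(|\sin(\theta_i-\theta_j)|)_{1\le i,j\le N}$, $\mathcal{C}_0^{(N)}=\{\bigoplus_{i=1}^N\alpha_iS_{\theta_i}:\alpha\in\mathbb{R}_+^N\}$ (the $0$-regular zonotopes with at most $2N$ faces), and let the $\mathcal{C}_0^{(N)}$-approximation of $K$ be $$K_0^{(N)}=\bigoplus_{i=1}^N\Bigl((F^{(N)})^{-1}\,{}^t(H_K(\theta_1),\dots,H_K(\theta_N))\Bigr)_i\,S_{\theta_i}.$$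 Let $X$ be a random symmetric convex set, that is, a random closed set in $\mathbb{R}^2$ on a probability space $(\Omega,\mathbb{P})$ whose realizations are almost surely symmetric convex, and for almost every $\omega$ let $X_0^{(N)}(\omega)$ be the $\mathcal{C}_0^{(N)}$-approximation of $X(\omega)$. Then: 1. For every $N>1$, $X_0^{(N)}$ is a $0$-regular random zonotope, i.e. a random closed set with realizations almost surely in $\mathcal{C}_0^{(N)}$; moreover $d_H(X,X_0^{(N)})$ and $\operatorname{diam}(X)$ are almost surely defined random variables. 2. For every $N>1$ and every real $a>0$, $$\mathbb{P}\bigl(d_H(X,X_0^{(N)})>a\bigr)\le\frac{6+2\sqrt2}{a}\,\sin\Bigl(\frac{\pi}{2N}\Bigr)\,\mathbb{E}[\operatorname{diam}(X)],$$ where the expectation is allowed to be $+\infty$. 3. For every $N>1$ and every $\epsilon\in[0,1]$, the number $a(\epsilon,N)=\frac{6+2\sqrt2}{\epsilon}\sin\bigl(\frac{\pi}{2N}\bigr)\mathbb{E}[\operatorname{diam}(X)]\in[0,\infty]$ is an upper bound for $d_H(X,X_0^{(N)})$ with confidence $1-\epsilon$: $$\mathbb{P}\bigl(d_H(X,X_0^{(N)})\le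 a(\epsilon,N)\bigr)\ge 1-\epsilon$$ (with the conventions $c/0=\infty$ for $c>0$ and $\infty\cdot 0=0$). 4. Consequently the approximation is consistent as $N\to\infty$: $d_H(X,X_0^{(N)})\to0$ in probability, i.e. $\mathbb{P}(d_H(X,X_0^{(N)})>a)\to0$ for every $a>0$. -/

import Mathlib

open MeasureTheory Filter Topology
open scoped Pointwise ENNReal

noncomputable section

namespace FeretZonotope

/-- The Euclidean plane. -/
abbrev Plane : Type := EuclideanSpace ℝ (Fin 2)

/-! ### Convex sets, support function and Feret diameter -/

/-- Symmetric convex sets of the plane: nonempty, compact and convex sets `X` that are symmetric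
in the sense of Minkowski, `X = (1/2) (X ⊕ (-X))`. -/
structure IsSymmetricConvex (X : Set Plane) : Prop where
  nonempty : X.Nonempty
  isCompact : IsCompact X
  convex : Convex ℝ X
  symmetric : X = (1 / 2 : ℝ) • (X + -X)

/-- The support function `f_X(x) = sup_{s ∈ X} ⟨x, s⟩`. -/
def supportFun (X : Set Plane) (x : Plane) : ℝ :=
  sSup ((fun s : Plane => inner ℝ x s) '' X)

/-- The angular form of the support function, `h_X(θ) = f_X(-sin θ, cos θ)`. -/
def angularSupport (X : Set Plane) (θ : ℝ) : ℝ :=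
  supportFun X !₂[-Real.sin θ, Real.cos θ]

/-- The Feret diameter `H_X(θ) = h_X(θ) + h_{-X}(θ)`. -/
def feretDiam (X : Set Plane) (θ : ℝ) : ℝ :=
  angularSupport X θ + angularSupport (-X) θ

/-- The maximal diameter `diam X = sup_θ H_X(θ)`. -/
def maxDiam (X : Set Plane) : ℝ :=
  ⨆ θ : ℝ, feretDiam X θ

/-! ### Zero-regular zonotopes and the approximation of a symmetric convex set -/

/-- The line segment `S_t` of length one, centred at the origin, with direction
`(cos t, sin t)`. -/
def unitSegment (t : ℝ) : Set Plane :=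
  (fun s : ℝ => s • (!₂[Real.cos t, Real.sin t] : Plane)) '' Set.Icc (-(1 / 2)) (1 / 2)

/-- The regular subdivision of `[0, π)`. The index runs through `0, …, N - 1`, so that
the angles are `i π / N`. -/
def regularAngle (N : ℕ) (i : Fin N) : ℝ :=
  (i : ℝ) * Real.pi / N

/-- The Minkowski sum `⨁ i, α_i S_{θ_i}` over the regular subdivision. -/
def regularSum (N : ℕ) (α : Fin N → ℝ) : Set Plane :=
  ∑ i, α i • unitSegment (regularAngle N i)

/-- The class of the `0`-regular zonotopes with at most `2 N` faces. -/
def zeroRegularZonotopes (N : ℕ) : Set (Set Plane) :=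
  {Z | ∃ α : Fin N → ℝ, (∀ i, 0 ≤ α i) ∧ Z = regularSum N α}

/-- The matrix `F = (|sin (θ_i - θ_j)|)`, which is invertible for `N ≥ 2`. -/
def sinMatrix (N : ℕ) : Matrix (Fin N) (Fin N) ℝ :=
  Matrix.of fun i j => |Real.sin (regularAngle N i - regularAngle N j)|

/-- The vector `F⁻¹ (H_X(θ_1), …, H_X(θ_N))`. -/
def faceLengths (N : ℕ) (X : Set Plane) : Fin N → ℝ :=
  (sinMatrix N)⁻¹.mulVec fun i => feretDiam X (regularAngle N i)

/-- The approximation `X_0^{(N)}` of `X` by a `0`-regular zonotope. -/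
def zeroApprox (N : ℕ) (X : Set Plane) : Set Plane :=
  regularSum N (faceLengths N X)

/-! ### Random sets -/

/-- A random closed set: a map into the closed sets that is measurable for the σ-algebra
generated by the families of the closed sets that hit a given compact set. -/
structure IsRandomClosedSet {Ω : Type*} [MeasurableSpace Ω] (X : Ω → Set Plane) : Prop where
  isClosed : ∀ ω, IsClosed (X ω)
  measurableSet_hits : ∀ K : Set Plane, IsCompact K → MeasurableSet {ω | (X ω ∩ K).Nonempty}

/-- A random symmetric convex set: a random closed set whose realizations are almost surely
symmetric convex sets. -/
structure IsRandomSymmetricConvex {Ω : Type*} [MeasurableSpace Ω] (P : Measure Ω)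
    (X : Ω → Set Plane) : Prop where
  isRandomClosedSet : IsRandomClosedSet X
  ae_symmetricConvex : ∀ᵐ ω ∂P, IsSymmetricConvex (X ω)

/-- A `0`-regular random zonotope with at most `2 N` faces: a random closed set whose
realizations are almost surely `0`-regular zonotopes. -/
structure IsZeroRegularRandomZonotope {Ω : Type*} [MeasurableSpace Ω] (P : Measure Ω) (N : ℕ)
    (X : Ω → Set Plane) : Prop where
  isRandomClosedSet : IsRandomClosedSet X
  ae_mem : ∀ᵐ ω ∂P, X ω ∈ zeroRegularZonotopes N

/-- The expectation `E[diam X]`, with values in `[0, ∞]`. -/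
def expectedDiam {Ω : Type*} [MeasurableSpace Ω] (P : Measure Ω) (X : Ω → Set Plane) : ℝ≥0∞ :=
  ∫⁻ ω, ENNReal.ofReal (maxDiam (X ω)) ∂P

/-- The Hausdorff distance between the realization `X(ω)` and its approximation. -/
def approxError {Ω : Type*} (X : Ω → Set Plane) (N : ℕ) (ω : Ω) : ℝ :=
  Metric.hausdorffDist (X ω) (zeroApprox N (X ω))

end FeretZonotope

end

/-! Put `h = π / N`. Everything rests on the second difference `f(θ + h) + f(θ - h) - 2 cos h ·
f(θ)`. At the points of the subdivision it annihilates `|sin(· - θ_j)|`, except at `θ_j`, where it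
gives `2 sin h`. The Feret diameter of a zonotope is a combination of these functions, so its
coefficients can be read off: the sine matrix is invertible, and the face lengths are second
differences of `H_K` divided by `2 sin h`. They are nonnegative because the support function is
sublinear and `u_{θ+h} + u_{θ-h} = 2 cos h · u_θ`.

Hence `K` and its approximation have equal support functions at all multiples of `h`. Every
direction is within `h / 2 ≤ π / 4` of such a multiple, which puts both sets in the disc of radius
`√2 · diam K / 2`. Their support functions are Lipschitz with that constant, and the Hausdorff
distance is the supremum of the difference of support functions (`hausdorffDist_le_iff`); this gives
the deterministic bound `hausdorffDist_zeroApprox_le`.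

The tail and confidence bounds are then Markov's inequality. Measurability reduces to hitting events
and to suprema over rational angles. -/

namespace FeretZonotope

/-! ### Unit vectors -/

/-- The unit vector `(-sin θ, cos θ)`. -/
noncomputable def unitNormal (θ : ℝ) : Plane := !₂[-Real.sin θ, Real.cos θ]

lemma inner_unitNormal (θ φ : ℝ) :
    inner ℝ (unitNormal θ) (unitNormal φ) = Real.cos (θ - φ) := by
  simp [unitNormal, PiLp.inner_apply, Fin.sum_univ_two, Real.cos_sub]
  ring

lemma norm_unitNormal (θ : ℝ) : ‖unitNormal θ‖ = 1 := by
  have h := real_inner_self_eq_norm_sq (unitNormal θ)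
  rw [inner_unitNormal, sub_self, Real.cos_zero] at h
  nlinarith [norm_nonneg (unitNormal θ)]

lemma norm_unitNormal_sub (θ φ : ℝ) :
    ‖unitNormal θ - unitNormal φ‖ = 2 * |Real.sin ((θ - φ) / 2)| := by
  have h := norm_sub_sq_real (unitNormal θ) (unitNormal φ)
  rw [inner_unitNormal, norm_unitNormal, norm_unitNormal,
    show θ - φ = 2 * ((θ - φ) / 2) by ring, Real.cos_two_mul] at h
  rw [← abs_of_nonneg (norm_nonneg (unitNormal θ - unitNormal φ)), ← abs_two, ← abs_mul,
    ← sq_eq_sq_iff_abs_eq_abs, h, mul_pow]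
  have := Real.sin_sq_add_cos_sq ((θ - φ) / 2)
  rw [abs_two]
  linarith

lemma unitNormal_add_pi (θ : ℝ) : unitNormal (θ + Real.pi) = -unitNormal θ := by
  ext i
  fin_cases i <;> simp [unitNormal]

lemma unitNormal_add_unitNormal (θ h : ℝ) :
    unitNormal (θ + h) + unitNormal (θ - h) = (2 * Real.cos h) • unitNormal θ := by
  ext i
  fin_cases i <;> simp [unitNormal, Real.sin_add, Real.sin_sub, Real.cos_add, Real.cos_sub] <;> ring

lemma continuous_unitNormal : Continuous unitNormal := by
  unfold unitNormal
  fun_prop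

lemma exists_eq_norm_smul_unitNormal (w : Plane) : ∃ θ : ℝ, w = ‖w‖ • unitNormal θ := by
  -- In complex notation `unitNormal θ` is `i · exp(iθ)`, so the angle sought is the argument of `w
  -- / i`.
  let z : ℂ := ⟨w 1, -w 0⟩
  have hz : ‖z‖ = ‖w‖ := by
    rw [EuclideanSpace.norm_eq, Fin.sum_univ_two, Complex.norm_eq_sqrt_sq_add_sq]
    congr 1
    simp [z, add_comm]
  refine ⟨z.arg, ?_⟩
  have h1 := Complex.norm_mul_cos_arg z
  have h2 := Complex.norm_mul_sin_arg z
  rw [hz] at h1 h2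
  ext i
  fin_cases i
  · simp [unitNormal, h2, z]
  · simp [unitNormal, h1, z]

/-! ### The support function -/

section Support

variable {A B : Set Plane}

lemma bddAbove_inner_image (hA : IsCompact A) (x : Plane) :
    BddAbove ((fun s : Plane => inner ℝ x s) '' A) :=
  (hA.image (by fun_prop)).bddAbove

lemma inner_le_supportFun (hA : IsCompact A) (x : Plane) {s : Plane} (hs : s ∈ A) :
    inner ℝ x s ≤ supportFun A x :=
  le_csSup (bddAbove_inner_image hA x) ⟨s, hs, rfl⟩

lemma supportFun_le (hne : A.Nonempty) {x : Plane} {c : ℝ} (h : ∀ s ∈ A, inner ℝ x s ≤ c) :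
    supportFun A x ≤ c :=
  csSup_le (hne.image _) (by rintro _ ⟨s, hs, rfl⟩; exact h s hs)

lemma supportFun_neg_set (A : Set Plane) (x : Plane) : supportFun (-A) x = supportFun A (-x) := by
  unfold supportFun
  congr 1
  rw [← Set.image_neg_eq_neg, Set.image_image]
  simp

lemma supportFun_add_le (hA : IsCompact A) (hne : A.Nonempty) (x y : Plane) :
    supportFun A (x + y) ≤ supportFun A x + supportFun A y :=
  supportFun_le hne fun s hs => by
    rw [inner_add_left]
    exact add_le_add (inner_le_supportFun hA x hs) (inner_le_supportFun hA y hs)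

lemma supportFun_smul (A : Set Plane) {c : ℝ} (hc : 0 ≤ c) (x : Plane) :
    supportFun A (c • x) = c * supportFun A x := by
  unfold supportFun
  rw [← smul_eq_mul, ← Real.sSup_smul_of_nonneg hc, ← Set.image_smul, Set.image_image]
  simp [inner_smul_left]

lemma supportFun_le_add_mul_norm (hA : IsCompact A) (hne : A.Nonempty) {ρ : ℝ}
    (hρ : ∀ s ∈ A, ‖s‖ ≤ ρ) (x y : Plane) :
    supportFun A x ≤ supportFun A y + ρ * ‖x - y‖ :=
  supportFun_le hne fun s hs => by
    have h1 : inner ℝ x s = inner ℝ y s + inner ℝ (x - y) s := by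
      rw [inner_sub_left]; ring
    have h2 := real_inner_le_norm (x - y) s
    have h3 := inner_le_supportFun hA y hs
    have h4 := mul_le_mul_of_nonneg_left (hρ s hs) (norm_nonneg (x - y))
    linarith

lemma abs_supportFun_sub_le (hA : IsCompact A) (hne : A.Nonempty) {ρ : ℝ}
    (hρ : ∀ s ∈ A, ‖s‖ ≤ ρ) (x y : Plane) :
    |supportFun A x - supportFun A y| ≤ ρ * ‖x - y‖ := by
  have h1 := supportFun_le_add_mul_norm hA hne hρ x y
  have h2 := supportFun_le_add_mul_norm hA hne hρ y x
  rw [norm_sub_rev y x] at h2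
  rw [abs_le]
  constructor <;> linarith

lemma exists_norm_le (hA : IsCompact A) : ∃ ρ : ℝ, 0 ≤ ρ ∧ ∀ s ∈ A, ‖s‖ ≤ ρ := by
  obtain ⟨ρ, hρ, h⟩ := hA.isBounded.exists_pos_norm_le
  exact ⟨ρ, hρ.le, h⟩

lemma continuous_supportFun (hA : IsCompact A) (hne : A.Nonempty) :
    Continuous (supportFun A) := by
  obtain ⟨ρ, hρ0, hρ⟩ := exists_norm_le hA
  refine (LipschitzWith.of_dist_le_mul (K := ⟨ρ, hρ0⟩) fun x y => ?_).continuous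
  rw [Real.dist_eq, dist_eq_norm]
  exact abs_supportFun_sub_le hA hne hρ x y

lemma angularSupport_eq (A : Set Plane) (θ : ℝ) :
    angularSupport A θ = supportFun A (unitNormal θ) := rfl

lemma continuous_angularSupport (hA : IsCompact A) (hne : A.Nonempty) :
    Continuous (angularSupport A) :=
  (continuous_supportFun hA hne).comp continuous_unitNormal

lemma abs_angularSupport_le (hA : IsCompact A) (hne : A.Nonempty) {ρ : ℝ}
    (hρ : ∀ s ∈ A, ‖s‖ ≤ ρ) (θ : ℝ) : |angularSupport A θ| ≤ ρ := by
  have h := abs_supportFun_sub_le hA hne hρ (unitNormal θ) 0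
  have h0 : supportFun A 0 = 0 := by
    simpa using supportFun_smul A le_rfl 0
  simpa [h0, norm_unitNormal, angularSupport_eq] using h

/-! ### The Hausdorff distance of convex bodies -/

/-- Project `p` to its nearest point `q` in `B`. The direction of `p - q` is an outer normal of `B`
at `q`, so in that direction the support functions already differ by at least `‖p - q‖`. -/
lemma infDist_le_of_angularSupport_le (hA : IsCompact A) (hB : IsCompact B) (hBne : B.Nonempty)
    (hBc : Convex ℝ B) {r : ℝ} (hr : 0 ≤ r)
    (h : ∀ θ, angularSupport A θ ≤ angularSupport B θ + r) {p : Plane} (hp : p ∈ A) :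
    Metric.infDist p B ≤ r := by
  obtain ⟨q, hq, hmin⟩ := exists_norm_eq_iInf_of_complete_convex hBne hB.isComplete hBc p
  rw [norm_eq_iInf_iff_real_inner_le_zero hBc hq] at hmin
  refine (Metric.infDist_le_dist_of_mem hq).trans ?_
  rw [dist_eq_norm]
  obtain ⟨θ, hθ⟩ := exists_eq_norm_smul_unitNormal (p - q)
  rcases eq_or_lt_of_le (norm_nonneg (p - q)) with h0 | h0
  · rw [← h0]; exact hr
  have h1 : supportFun B (unitNormal θ) ≤ inner ℝ (unitNormal θ) q :=
    supportFun_le hBne fun s hs => by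
      have h2 := hmin s hs
      rw [hθ, inner_smul_left, inner_sub_right] at h2
      have h3 := nonpos_of_mul_nonpos_right h2 h0
      linarith
  have h2 : inner ℝ (unitNormal θ) (p - q) = ‖p - q‖ := by
    conv_lhs => rw [hθ]
    rw [inner_smul_right, inner_unitNormal]
    simp
  rw [inner_sub_right] at h2
  have h3 := inner_le_supportFun hA (unitNormal θ) hp
  have h4 := h θ
  simp only [angularSupport_eq] at h4
  linarith

lemma angularSupport_le_add_hausdorffDist (hA : IsCompact A) (hAne : A.Nonempty)
    (hB : IsCompact B) (hBne : B.Nonempty) (θ : ℝ) :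
    angularSupport A θ ≤ angularSupport B θ + Metric.hausdorffDist A B :=
  supportFun_le hAne fun s hs => by
    obtain ⟨b, hb, hsb⟩ := hB.exists_infDist_eq_dist hBne s
    have h1 := Metric.infDist_le_hausdorffDist_of_mem hs
      (Metric.hausdorffEDist_ne_top_of_nonempty_of_bounded hAne hBne hA.isBounded hB.isBounded)
    rw [hsb, dist_eq_norm] at h1
    have h2 := inner_le_supportFun hB (unitNormal θ) hb
    have h3 := real_inner_le_norm (unitNormal θ) (s - b)
    rw [inner_sub_right, norm_unitNormal, one_mul] at h3
    change inner ℝ (unitNormal θ) s ≤ supportFun B (unitNormal θ) + _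
    linarith

lemma hausdorffDist_le_iff (hA : IsCompact A) (hAne : A.Nonempty) (hAc : Convex ℝ A)
    (hB : IsCompact B) (hBne : B.Nonempty) (hBc : Convex ℝ B) (r : ℝ) :
    Metric.hausdorffDist A B ≤ r ↔ ∀ θ, |angularSupport A θ - angularSupport B θ| ≤ r := by
  constructor
  · intro h θ
    have h1 := angularSupport_le_add_hausdorffDist hA hAne hB hBne θ
    have h2 := angularSupport_le_add_hausdorffDist hB hBne hA hAne θ
    rw [Metric.hausdorffDist_comm] at h2
    rw [abs_le]
    constructor <;> linarith
  · intro h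
    have hr : 0 ≤ r := (abs_nonneg _).trans (h 0)
    refine Metric.hausdorffDist_le_of_infDist hr (fun p hp => ?_) fun p hp => ?_
    · exact infDist_le_of_angularSupport_le hA hB hBne hBc hr
        (fun θ => by linarith [(abs_le.1 (h θ)).2]) hp
    · exact infDist_le_of_angularSupport_le hB hA hAne hAc hr
        (fun θ => by linarith [(abs_le.1 (h θ)).1]) hp

lemma hausdorffDist_eq_iSup (hA : IsCompact A) (hAne : A.Nonempty) (hAc : Convex ℝ A)
    (hB : IsCompact B) (hBne : B.Nonempty) (hBc : Convex ℝ B) :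
    Metric.hausdorffDist A B = ⨆ θ : ℝ, |angularSupport A θ - angularSupport B θ| := by
  have h := (hausdorffDist_le_iff hA hAne hAc hB hBne hBc _).1 le_rfl
  refine le_antisymm ?_ (ciSup_le h)
  rw [hausdorffDist_le_iff hA hAne hAc hB hBne hBc]
  exact le_ciSup ⟨_, Set.forall_mem_range.2 h⟩

end Support

lemma iSup_rat_eq_iSup {f : ℝ → ℝ} (hf : Continuous f) : ⨆ q : ℚ, f q = ⨆ x, f x := by
  rw [← Rat.isDenseEmbedding_coe_real.dense.ciSup' hf, iSup_range']

/-! ### Symmetric convex sets -/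

namespace IsSymmetricConvex

variable {K : Set Plane}

lemma neg_eq (hK : IsSymmetricConvex K) : -K = K := by
  rw [hK.symmetric, ← Set.smul_set_neg, neg_add, neg_neg, add_comm]

lemma supportFun_neg (hK : IsSymmetricConvex K) (x : Plane) :
    supportFun K (-x) = supportFun K x := by
  rw [← supportFun_neg_set, hK.neg_eq]

lemma feretDiam_eq (hK : IsSymmetricConvex K) (θ : ℝ) :
    feretDiam K θ = 2 * angularSupport K θ := by
  rw [feretDiam, hK.neg_eq, two_mul]

lemma feretDiam_add_pi (hK : IsSymmetricConvex K) (θ : ℝ) :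
    feretDiam K (θ + Real.pi) = feretDiam K θ := by
  simp only [hK.feretDiam_eq, angularSupport_eq, unitNormal_add_pi, hK.supportFun_neg]

lemma continuous_feretDiam (hK : IsSymmetricConvex K) : Continuous (feretDiam K) := by
  rw [funext hK.feretDiam_eq]
  exact (continuous_angularSupport hK.isCompact hK.nonempty).const_mul 2

lemma bddAbove_feretDiam (hK : IsSymmetricConvex K) : BddAbove (Set.range (feretDiam K)) := by
  obtain ⟨ρ, -, hρ⟩ := exists_norm_le hK.isCompact
  refine ⟨2 * ρ, ?_⟩
  rintro _ ⟨θ, rfl⟩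
  have := abs_angularSupport_le hK.isCompact hK.nonempty hρ θ
  rw [hK.feretDiam_eq]
  linarith [le_abs_self (angularSupport K θ)]

lemma angularSupport_le_half_maxDiam (hK : IsSymmetricConvex K) (θ : ℝ) :
    angularSupport K θ ≤ maxDiam K / 2 := by
  have h := le_ciSup hK.bddAbove_feretDiam θ
  rw [hK.feretDiam_eq] at h
  rw [maxDiam]
  linarith

lemma abs_inner_unitNormal_le (hK : IsSymmetricConvex K) {s : Plane} (hs : s ∈ K) (θ : ℝ) :
    |inner ℝ (unitNormal θ) s| ≤ angularSupport K θ := by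
  refine abs_le'.2 ⟨inner_le_supportFun hK.isCompact _ hs, ?_⟩
  rw [← inner_neg_left, angularSupport_eq, ← hK.supportFun_neg]
  exact inner_le_supportFun hK.isCompact _ hs

lemma angularSupport_nonneg (hK : IsSymmetricConvex K) (θ : ℝ) : 0 ≤ angularSupport K θ := by
  obtain ⟨s, hs⟩ := hK.nonempty
  exact (abs_nonneg _).trans (hK.abs_inner_unitNormal_le hs θ)

lemma maxDiam_nonneg (hK : IsSymmetricConvex K) : 0 ≤ maxDiam K := by
  linarith [hK.angularSupport_nonneg 0, hK.angularSupport_le_half_maxDiam 0]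

/-- Subadditivity of the support function at two normals whose sum is `2 cos h` times the middle
one. This is what makes the face lengths nonnegative. -/
lemma feretDiam_second_difference_nonneg (hK : IsSymmetricConvex K) {h : ℝ}
    (hh : 0 ≤ Real.cos h) (θ : ℝ) :
    0 ≤ feretDiam K (θ + h) + feretDiam K (θ - h) - 2 * Real.cos h * feretDiam K θ := by
  have h1 := supportFun_add_le hK.isCompact hK.nonempty (unitNormal (θ + h)) (unitNormal (θ - h))
  rw [unitNormal_add_unitNormal, supportFun_smul _ (by positivity)] at h1
  simp only [hK.feretDiam_eq, angularSupport_eq]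
  linarith

end IsSymmetricConvex

/-! ### Zonotopes over the regular subdivision -/

lemma mem_regularSum {N : ℕ} {α : Fin N → ℝ} {x : Plane} :
    x ∈ regularSum N α ↔ ∃ c ∈ Set.univ.pi fun _ : Fin N => Set.Icc (-(1 / 2) : ℝ) (1 / 2),
      ∑ i, (α i * c i) •
        (!₂[Real.cos (regularAngle N i), Real.sin (regularAngle N i)] : Plane) = x := by
  rw [regularSum, Set.mem_finsetSum]
  constructor
  · rintro ⟨g, hg, rfl⟩
    have h : ∀ i, ∃ c ∈ Set.Icc (-(1 / 2) : ℝ) (1 / 2), (α i * c) •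
        (!₂[Real.cos (regularAngle N i), Real.sin (regularAngle N i)] : Plane) = g i := by
      intro i
      obtain ⟨_, ⟨c, hc, rfl⟩, h⟩ := hg (Finset.mem_univ i)
      exact ⟨c, hc, by rw [mul_smul]; exact h⟩
    choose c hc hcg using h
    exact ⟨c, fun i _ => hc i, Finset.sum_congr rfl fun i _ => hcg i⟩
  · rintro ⟨c, hc, rfl⟩
    refine ⟨_, fun {i} _ => ?_, rfl⟩
    exact ⟨_, ⟨c i, hc i trivial, rfl⟩, (mul_smul _ _ _).symm⟩

lemma regularSum_eq_image (N : ℕ) (α : Fin N → ℝ) :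
    regularSum N α = (fun c : Fin N → ℝ => ∑ i, (α i * c i) •
        (!₂[Real.cos (regularAngle N i), Real.sin (regularAngle N i)] : Plane)) ''
      Set.univ.pi fun _ => Set.Icc (-(1 / 2) : ℝ) (1 / 2) := by
  ext x
  exact mem_regularSum

lemma isCompact_regularSum (N : ℕ) (α : Fin N → ℝ) : IsCompact (regularSum N α) := by
  rw [regularSum_eq_image]
  exact (isCompact_univ_pi fun _ => isCompact_Icc).image (by fun_prop)

lemma isSymmetricConvex_regularSum (N : ℕ) (α : Fin N → ℝ) :
    IsSymmetricConvex (regularSum N α) := by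
  have hc : Convex ℝ (regularSum N α) := by
    rintro x hx y hy a b ha hb hab
    obtain ⟨c, hc, rfl⟩ := mem_regularSum.1 hx
    obtain ⟨d, hd, rfl⟩ := mem_regularSum.1 hy
    refine mem_regularSum.2 ⟨a • c + b • d,
      convex_pi (fun _ _ => convex_Icc _ _) hc hd ha hb hab, ?_⟩
    simp only [Finset.smul_sum, ← Finset.sum_add_distrib, smul_smul, ← add_smul]
    refine Finset.sum_congr rfl fun i _ => ?_
    congr 1
    simp only [Pi.add_apply, Pi.smul_apply, smul_eq_mul]
    ring
  have hneg : -regularSum N α = regularSum N α := by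
    have h : ∀ x ∈ regularSum N α, -x ∈ regularSum N α := by
      intro x hx
      obtain ⟨c, hc, rfl⟩ := mem_regularSum.1 hx
      refine mem_regularSum.2 ⟨-c, fun i _ => ?_, by simp⟩
      obtain ⟨h1, h2⟩ := hc i trivial
      exact ⟨neg_le_neg h2, by simpa using neg_le_neg h1⟩
    ext x
    exact ⟨fun hx => by simpa using h _ hx, fun hx => h x hx⟩
  refine ⟨⟨0, mem_regularSum.2 ⟨0, fun i _ => by simp, by simp⟩⟩, isCompact_regularSum N α, hc, ?_⟩
  rw [hneg, smul_add, ← hc.add_smul (by norm_num) (by norm_num)]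
  norm_num

/-- The set is a projection along the compact cube of coefficients, hence closed. Through it,
measurable face lengths yield a random closed set. -/
lemma isClosed_setOf_regularSum_inter_nonempty (N : ℕ) {K : Set Plane} (hK : IsClosed K) :
    IsClosed {α | (regularSum N α ∩ K).Nonempty} := by
  let Q : Set (Fin N → ℝ) := Set.univ.pi fun _ => Set.Icc (-(1 / 2) : ℝ) (1 / 2)
  have : CompactSpace Q := isCompact_iff_compactSpace.1 (isCompact_univ_pi fun _ => isCompact_Icc)
  let g : (Fin N → ℝ) × Q → Plane := fun p => ∑ i, (p.1 i * p.2.1 i) •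
        (!₂[Real.cos (regularAngle N i), Real.sin (regularAngle N i)] : Plane)
  have hg : Continuous g := by
    refine continuous_finsetSum _ fun i _ => Continuous.fun_smul ?_ continuous_const
    exact ((continuous_apply i).comp continuous_fst).mul
      ((continuous_apply i).comp (continuous_subtype_val.comp continuous_snd))
  convert isClosedMap_fst_of_compactSpace _ (hK.preimage hg) using 1
  ext α
  constructor
  · rintro ⟨x, hx, hxK⟩
    obtain ⟨c, hc, rfl⟩ := mem_regularSum.1 hx
    exact ⟨(α, ⟨c, hc⟩), hxK, rfl⟩
  · rintro ⟨⟨β, c⟩, hxK, rfl⟩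
    exact ⟨_, mem_regularSum.2 ⟨c, c.2, rfl⟩, hxK⟩

lemma inner_unitNormal_direction (θ φ : ℝ) :
    inner ℝ (unitNormal θ) (!₂[Real.cos φ, Real.sin φ] : Plane) = -Real.sin (θ - φ) := by
  simp [unitNormal, PiLp.inner_apply, Fin.sum_univ_two, Real.sin_sub]
  ring

lemma feretDiam_regularSum {N : ℕ} {α : Fin N → ℝ} (hα : ∀ i, 0 ≤ α i) (θ : ℝ) :
    feretDiam (regularSum N α) θ = ∑ i, α i * |Real.sin (θ - regularAngle N i)| := by
  have hS := isSymmetricConvex_regularSum N α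
  have hinner : ∀ c : Fin N → ℝ, inner ℝ (unitNormal θ) (∑ i, (α i * c i) •
        (!₂[Real.cos (regularAngle N i), Real.sin (regularAngle N i)] : Plane)) =
      ∑ i, α i * (c i * -Real.sin (θ - regularAngle N i)) := fun c => by
    simp only [inner_sum, inner_smul_right, inner_unitNormal_direction, mul_assoc]
  rw [hS.feretDiam_eq, angularSupport_eq]
  have key : supportFun (regularSum N α) (unitNormal θ) =
      ∑ i, α i * (1 / 2 * |Real.sin (θ - regularAngle N i)|) := by
    refine le_antisymm (supportFun_le hS.nonempty fun s hs => ?_) ?_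
    · obtain ⟨c, hc, rfl⟩ := mem_regularSum.1 hs
      rw [hinner]
      refine Finset.sum_le_sum fun i _ => mul_le_mul_of_nonneg_left ?_ (hα i)
      refine (le_abs_self _).trans ?_
      rw [abs_mul, abs_neg]
      exact mul_le_mul_of_nonneg_right (abs_le.2 (hc i trivial)) (abs_nonneg _)
    -- The inner product carries the factor `-sin`, so the maximizing coefficient has the sign
    -- opposite to the sine.
    · let c : Fin N → ℝ := fun i =>
        if 0 ≤ Real.sin (θ - regularAngle N i) then -(1 / 2) else 1 / 2
      have hc : c ∈ Set.univ.pi fun _ : Fin N => Set.Icc (-(1 / 2) : ℝ) (1 / 2) := by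
        intro i _
        simp only [c]
        split_ifs <;> norm_num
      refine le_of_eq_of_le ?_ (inner_le_supportFun hS.isCompact _ (mem_regularSum.2 ⟨c, hc, rfl⟩))
      rw [hinner]
      refine Finset.sum_congr rfl fun i _ => ?_
      congr 1
      simp only [c]
      split_ifs with h
      · rw [abs_of_nonneg h]; ring
      · rw [abs_of_neg (not_le.1 h)]
  rw [key, Finset.mul_sum]
  exact Finset.sum_congr rfl fun i _ => by ring

/-! ### Inversion of the matrix of sines -/

lemma regularAngle_eq (N : ℕ) (i : Fin N) : regularAngle N i = (i : ℝ) * (Real.pi / N) := by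
  rw [regularAngle, mul_div_assoc]

/-- For `1 ≤ m ≤ N - 1` all three angles lie in `[0, π]`, so the absolute values disappear and the
addition formulas apply. -/
lemma abs_sin_second_difference_eq_zero {N : ℕ} {m : ℕ} (hm : 1 ≤ m) (hmN : m + 1 ≤ N) :
    |Real.sin (m * (Real.pi / N) + Real.pi / N)| + |Real.sin (m * (Real.pi / N) - Real.pi / N)| -
      2 * Real.cos (Real.pi / N) * |Real.sin (m * (Real.pi / N))| = 0 := by
  have hN : (0 : ℝ) < N := by exact_mod_cast (by omega : 0 < N)
  have hh : 0 < Real.pi / N := by positivity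
  have hmul : N * (Real.pi / N) = Real.pi := by field_simp
  have h1 : (1 : ℝ) ≤ m := by exact_mod_cast hm
  have h2 : (m + 1 : ℝ) ≤ N := by exact_mod_cast hmN
  have h3 : m * (Real.pi / N) + Real.pi / N ≤ Real.pi := by
    have := mul_le_mul_of_nonneg_right h2 hh.le
    linarith
  have h4 : Real.pi / N ≤ m * (Real.pi / N) := le_mul_of_one_le_left hh.le h1
  rw [abs_of_nonneg (Real.sin_nonneg_of_nonneg_of_le_pi (by linarith) h3),
    abs_of_nonneg (Real.sin_nonneg_of_nonneg_of_le_pi (by linarith) (by linarith)),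
    abs_of_nonneg (Real.sin_nonneg_of_nonneg_of_le_pi (by linarith) (by linarith)),
    Real.sin_add, Real.sin_sub]
  ring

lemma abs_sin_regularAngle_second_difference {N : ℕ} (i j : Fin N) :
    |Real.sin (regularAngle N i + Real.pi / N - regularAngle N j)| +
      |Real.sin (regularAngle N i - Real.pi / N - regularAngle N j)| -
      2 * Real.cos (Real.pi / N) * |Real.sin (regularAngle N i - regularAngle N j)| =
    if i = j then 2 * Real.sin (Real.pi / N) else 0 := by
  have hN : (1 : ℝ) ≤ N := by exact_mod_cast (by have := i.2; omega : 1 ≤ N)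
  have hs : 0 ≤ Real.sin (Real.pi / N) :=
    Real.sin_nonneg_of_nonneg_of_le_pi (by positivity) (div_le_self Real.pi_pos.le hN)
  simp only [regularAngle_eq]
  rcases lt_trichotomy (i : ℕ) j with h | h | h
  · rw [if_neg (fun e => by rw [e] at h; exact lt_irrefl _ h)]
    obtain ⟨m, hm⟩ := Nat.exists_eq_add_of_lt h
    -- Here the differences of angles are negative; passing to their opposites swaps the two shifted
    -- terms.
    rw [← abs_sin_second_difference_eq_zero (N := N) (m := m + 1) (by omega)
      (by have := j.2; omega), hm, add_comm |_|]
    push_cast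
    congr 2
    · rw [← abs_neg, ← Real.sin_neg]; ring_nf
    · rw [← abs_neg, ← Real.sin_neg]; ring_nf
    · rw [← abs_neg, ← Real.sin_neg]; ring_nf
  · rw [if_pos (Fin.ext h), h]
    simp only [add_sub_cancel_left, sub_sub_cancel_left, sub_self, Real.sin_neg, abs_neg,
      abs_of_nonneg hs, Real.sin_zero, abs_zero]
    ring
  · rw [if_neg (fun e => by rw [e] at h; exact lt_irrefl _ h)]
    obtain ⟨m, hm⟩ := Nat.exists_eq_add_of_lt h
    rw [← abs_sin_second_difference_eq_zero (N := N) (m := m + 1) (by omega)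
      (by have := i.2; omega), hm]
    push_cast
    ring_nf

lemma sum_abs_sin_second_difference {N : ℕ} (v : Fin N → ℝ) (i : Fin N) :
    (∑ j, v j * |Real.sin (regularAngle N i + Real.pi / N - regularAngle N j)|) +
      (∑ j, v j * |Real.sin (regularAngle N i - Real.pi / N - regularAngle N j)|) -
      2 * Real.cos (Real.pi / N) *
        ∑ j, v j * |Real.sin (regularAngle N i - regularAngle N j)| =
    2 * Real.sin (Real.pi / N) * v i := by
  have h : ∀ j, v j * |Real.sin (regularAngle N i + Real.pi / N - regularAngle N j)| +
      v j * |Real.sin (regularAngle N i - Real.pi / N - regularAngle N j)| -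
      2 * Real.cos (Real.pi / N) *
        (v j * |Real.sin (regularAngle N i - regularAngle N j)|) =
      v j * if i = j then 2 * Real.sin (Real.pi / N) else 0 := fun j => by
    rw [← abs_sin_regularAngle_second_difference i j]
    ring
  rw [Finset.mul_sum, ← Finset.sum_add_distrib, ← Finset.sum_sub_distrib,
    Finset.sum_congr rfl fun j _ => h j]
  simp [mul_comm]

/-- Two `π`-periodic functions that agree on the regular subdivision agree at all integral
multiples of `π / N`. -/
lemma eq_of_eq_regularAngle {N : ℕ} (hN : 0 < N) {f g : ℝ → ℝ}
    (hf : Function.Periodic f Real.pi) (hg : Function.Periodic g Real.pi)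
    (h : ∀ i : Fin N, f (regularAngle N i) = g (regularAngle N i)) (k : ℤ) :
    f (k * (Real.pi / N)) = g (k * (Real.pi / N)) := by
  have hN0 : (N : ℤ) ≠ 0 := by exact_mod_cast hN.ne'
  have hNR : (N : ℝ) ≠ 0 := by exact_mod_cast hN.ne'
  have h1 := Int.emod_nonneg k hN0
  have h2 := Int.emod_lt_of_pos k (by exact_mod_cast hN : (0 : ℤ) < N)
  obtain ⟨m, hm⟩ := Int.eq_ofNat_of_zero_le h1
  have hk : (k : ℝ) * (Real.pi / N) =
      regularAngle N ⟨m, by omega⟩ + (k / (N : ℤ) : ℤ) * Real.pi := by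
    have h3 : (k : ℝ) = m + N * (k / (N : ℤ) : ℤ) := by
      exact_mod_cast (by rw [← hm, Int.emod_add_mul_ediv] : k = m + N * (k / (N : ℤ)))
    rw [regularAngle_eq, h3]
    field_simp
  rw [hk, hf.int_mul, hg.int_mul, h]

lemma periodic_sum_abs_sin {N : ℕ} (v : Fin N → ℝ) :
    Function.Periodic (fun θ => ∑ j, v j * |Real.sin (θ - regularAngle N j)|) Real.pi := by
  intro θ
  refine Finset.sum_congr rfl fun j _ => ?_
  rw [add_sub_right_comm, Real.sin_add_pi, abs_neg]

lemma sin_pi_div_pos {N : ℕ} (hN : 1 < N) : 0 < Real.sin (Real.pi / N) := by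
  have h : (1 : ℝ) < N := by exact_mod_cast hN
  exact Real.sin_pos_of_pos_of_lt_pi (by positivity) (div_lt_self Real.pi_pos h)

lemma pi_div_le_pi_div_two {N : ℕ} (hN : 1 < N) : Real.pi / N ≤ Real.pi / 2 := by
  have h : (2 : ℝ) ≤ N := by exact_mod_cast hN
  have := Real.pi_pos
  gcongr

lemma cos_pi_div_nonneg {N : ℕ} (hN : 1 < N) : 0 ≤ Real.cos (Real.pi / N) :=
  Real.cos_nonneg_of_neg_pi_div_two_le_of_le
    (by have := Real.pi_pos; have : 0 ≤ Real.pi / N := by positivity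
        linarith) (pi_div_le_pi_div_two hN)

lemma sinMatrix_mulVec (N : ℕ) (v : Fin N → ℝ) (i : Fin N) :
    (sinMatrix N).mulVec v i = ∑ j, v j * |Real.sin (regularAngle N i - regularAngle N j)| := by
  simp only [Matrix.mulVec, dotProduct, sinMatrix, Matrix.of_apply, mul_comm]

/-- Explicit inversion of the sine matrix. Periodicity is needed at the two ends of the subdivision,
where a shift by `π / N` leaves it. -/
lemma second_difference_of_eq_sum {N : ℕ} (hN : 0 < N) {f : ℝ → ℝ}
    (hf : Function.Periodic f Real.pi) {v : Fin N → ℝ}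
    (h : ∀ i, (sinMatrix N).mulVec v i = f (regularAngle N i)) (i : Fin N) :
    2 * Real.sin (Real.pi / N) * v i =
      f (regularAngle N i + Real.pi / N) + f (regularAngle N i - Real.pi / N) -
        2 * Real.cos (Real.pi / N) * f (regularAngle N i) := by
  have h' := eq_of_eq_regularAngle hN (periodic_sum_abs_sin v) hf
    fun i => (sinMatrix_mulVec N v i).symm.trans (h i)
  have h1 := h' (i + 1)
  have h2 := h' (i - 1)
  have h3 := h' i
  push_cast at h1 h2 h3
  rw [add_mul, one_mul, ← regularAngle_eq] at h1
  rw [sub_mul, one_mul, ← regularAngle_eq] at h2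
  rw [← regularAngle_eq] at h3
  rw [← sum_abs_sin_second_difference, ← h1, ← h2, ← h3]

lemma isUnit_det_sinMatrix {N : ℕ} (hN : 1 < N) : IsUnit (sinMatrix N).det := by
  rw [isUnit_iff_ne_zero, ne_eq, ← Matrix.exists_mulVec_eq_zero_iff]
  rintro ⟨v, hv, h0⟩
  refine hv (funext fun i => ?_)
  have h := second_difference_of_eq_sum (f := fun _ => 0) (v := v) (by omega : 0 < N)
    (fun _ => rfl) (fun i => by rw [h0]; rfl) i
  have hs := sin_pi_div_pos hN
  simpa [hs.ne'] using h

lemma sinMatrix_mulVec_faceLengths {N : ℕ} (hN : 1 < N) (K : Set Plane) (i : Fin N) :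
    (sinMatrix N).mulVec (faceLengths N K) i = feretDiam K (regularAngle N i) := by
  rw [faceLengths, Matrix.mulVec_mulVec, Matrix.mul_nonsing_inv _ (isUnit_det_sinMatrix hN),
    Matrix.one_mulVec]

namespace IsSymmetricConvex

variable {K : Set Plane} {N : ℕ}

lemma faceLengths_nonneg (hK : IsSymmetricConvex K) (hN : 1 < N) (i : Fin N) :
    0 ≤ faceLengths N K i := by
  have h := second_difference_of_eq_sum (by omega) hK.feretDiam_add_pi
    (sinMatrix_mulVec_faceLengths hN K) i
  have h1 := hK.feretDiam_second_difference_nonneg (cos_pi_div_nonneg hN) (regularAngle N i)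
  rw [← h] at h1
  have hs := sin_pi_div_pos hN
  exact nonneg_of_mul_nonneg_right h1 (by positivity)

lemma zeroApprox_mem (hK : IsSymmetricConvex K) (hN : 1 < N) :
    zeroApprox N K ∈ zeroRegularZonotopes N :=
  ⟨_, hK.faceLengths_nonneg hN, rfl⟩

lemma angularSupport_zeroApprox (hK : IsSymmetricConvex K) (hN : 1 < N) (k : ℤ) :
    angularSupport (zeroApprox N K) (k * (Real.pi / N)) =
      angularSupport K (k * (Real.pi / N)) := by
  have hS := isSymmetricConvex_regularSum N (faceLengths N K)
  have h := eq_of_eq_regularAngle (by omega : 0 < N) hS.feretDiam_add_pi hK.feretDiam_add_pi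
    (fun i => by
      rw [feretDiam_regularSum (hK.faceLengths_nonneg hN), ← sinMatrix_mulVec,
        sinMatrix_mulVec_faceLengths hN]) k
  rw [hS.feretDiam_eq, hK.feretDiam_eq] at h
  rw [zeroApprox]
  linarith

end IsSymmetricConvex

/-! ### The approximation error -/

lemma exists_int_abs_sub_mul_le (θ : ℝ) {h : ℝ} (hh : 0 < h) : ∃ k : ℤ, |θ - k * h| ≤ h / 2 := by
  refine ⟨round (θ / h), ?_⟩
  have h1 := abs_sub_round (θ / h)
  have h2 : θ - round (θ / h) * h = (θ / h - round (θ / h)) * h := by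
    rw [sub_mul, div_mul_cancel₀ _ hh.ne']
  rw [h2, abs_mul, abs_of_pos hh]
  nlinarith

/-- Some grid normal makes an angle of at most `π / 4` with `p`, and `cos (π / 4) = √2 / 2`. -/
lemma norm_le_of_inner_unitNormal_le {N : ℕ} (hN : 1 < N) {R : ℝ} {p : Plane}
    (h : ∀ k : ℤ, inner ℝ (unitNormal (k * (Real.pi / N))) p ≤ R) : ‖p‖ ≤ √2 * R := by
  obtain ⟨θ, hθ⟩ := exists_eq_norm_smul_unitNormal p
  have hN0 : (0 : ℝ) < N := by exact_mod_cast (by omega : 0 < N)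
  obtain ⟨k, hk⟩ := exists_int_abs_sub_mul_le θ (show 0 < Real.pi / N by positivity)
  have hpi := pi_div_le_pi_div_two hN
  have h1 := h k
  rw [hθ, inner_smul_right, inner_unitNormal, ← Real.cos_abs, abs_sub_comm] at h1
  have h2 : √2 / 2 ≤ Real.cos |θ - k * (Real.pi / N)| := by
    rw [← Real.cos_pi_div_four]
    exact Real.cos_le_cos_of_nonneg_of_le_pi (abs_nonneg _) (by linarith [Real.pi_pos])
      (by linarith)
  have h3 := (mul_le_mul_of_nonneg_left h2 (norm_nonneg p)).trans h1
  have h4 := mul_le_mul_of_nonneg_left h3 (Real.sqrt_nonneg 2)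
  have h5 : √2 * (‖p‖ * (√2 / 2)) = ‖p‖ * (√2 * √2) / 2 := by ring
  rw [h5, Real.mul_self_sqrt zero_le_two] at h4
  linarith

/-- The exact chord length would allow `π / (4 N)` in the sine; the coarser angle matches the final
estimate. -/
lemma norm_unitNormal_sub_le {N : ℕ} (hN : 1 < N) {θ φ : ℝ} (h : |θ - φ| ≤ Real.pi / N / 2) :
    ‖unitNormal θ - unitNormal φ‖ ≤ 2 * Real.sin (Real.pi / (2 * N)) := by
  have hpi := pi_div_le_pi_div_two hN
  have h0 : |(θ - φ) / 2| ≤ Real.pi / (2 * N) := by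
    rw [abs_div, abs_two, show Real.pi / (2 * N) = Real.pi / N / 2 by rw [div_div, mul_comm]]
    linarith [abs_nonneg (θ - φ)]
  have h1 : Real.pi / (2 * N) ≤ Real.pi / 2 := by
    rw [show Real.pi / (2 * N) = Real.pi / N / 2 by rw [div_div, mul_comm]]
    linarith [Real.pi_pos]
  rw [norm_unitNormal_sub, Real.abs_sin_eq_sin_abs_of_abs_le_pi (by linarith [Real.pi_pos])]
  gcongr
  exact Real.sin_le_sin_of_le_of_le_pi_div_two (by linarith [abs_nonneg ((θ - φ) / 2),
    Real.pi_pos]) h1 h0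

lemma IsSymmetricConvex.hausdorffDist_zeroApprox_le {K : Set Plane} (hK : IsSymmetricConvex K)
    {N : ℕ} (hN : 1 < N) :
    Metric.hausdorffDist K (zeroApprox N K) ≤
      (6 + 2 * √2) * Real.sin (Real.pi / (2 * N)) * maxDiam K := by
  have hS : IsSymmetricConvex (zeroApprox N K) := isSymmetricConvex_regularSum N _
  have hK1 : ∀ s ∈ K, ‖s‖ ≤ √2 * (maxDiam K / 2) := fun s hs =>
    norm_le_of_inner_unitNormal_le hN fun k =>
      (inner_le_supportFun hK.isCompact _ hs).trans (hK.angularSupport_le_half_maxDiam _)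
  have hS1 : ∀ s ∈ zeroApprox N K, ‖s‖ ≤ √2 * (maxDiam K / 2) := fun s hs =>
    norm_le_of_inner_unitNormal_le hN fun k =>
      (inner_le_supportFun hS.isCompact _ hs).trans <|
        (hK.angularSupport_zeroApprox hN k).le.trans (hK.angularSupport_le_half_maxDiam _)
  rw [hausdorffDist_le_iff hK.isCompact hK.nonempty hK.convex hS.isCompact hS.nonempty hS.convex]
  intro θ
  have hN0 : (0 : ℝ) < N := by exact_mod_cast (by omega : 0 < N)
  obtain ⟨k, hk⟩ := exists_int_abs_sub_mul_le θ (show 0 < Real.pi / N by positivity)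
  have h1 := abs_le.1 (abs_supportFun_sub_le hK.isCompact hK.nonempty hK1 (unitNormal θ)
    (unitNormal (k * (Real.pi / N))))
  have h2 := abs_le.1 (abs_supportFun_sub_le hS.isCompact hS.nonempty hS1 (unitNormal θ)
    (unitNormal (k * (Real.pi / N))))
  have h3 := hK.angularSupport_zeroApprox hN k
  have hd := hK.maxDiam_nonneg
  have h4 := norm_unitNormal_sub_le hN hk
  have hs : 0 ≤ Real.sin (Real.pi / (2 * N)) := by
    linarith [norm_nonneg (unitNormal θ - unitNormal (k * (Real.pi / N)))]
  have h5 := mul_le_mul_of_nonneg_left h4 (show 0 ≤ √2 * (maxDiam K / 2) by positivity)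
  -- Two Lipschitz estimates, each with constant `√2 · diam K / 2` over a distance of at most `2 sin
  -- (π / (2 N))`, give the factor `2 √2`. The summand `6` is slack.
  have h6 : 0 ≤ 6 * (Real.sin (Real.pi / (2 * N)) * maxDiam K) := by positivity
  simp only [angularSupport_eq] at h3 ⊢
  rw [abs_le]
  constructor <;> nlinarith

/-! ### Measurability -/

section Measurability

variable {Ω : Type*} [MeasurableSpace Ω] {P : Measure Ω} {X : Ω → Set Plane}

lemma IsRandomClosedSet.measurableSet_inter_iUnion_nonempty (hX : IsRandomClosedSet X)
    {K : ℕ → Set Plane} (hK : ∀ n, IsCompact (K n)) :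
    MeasurableSet {ω | (X ω ∩ ⋃ n, K n).Nonempty} := by
  simp only [Set.inter_iUnion, Set.nonempty_iUnion, Set.ofPred_exists]
  exact MeasurableSet.iUnion fun n => hX.measurableSet_hits _ (hK n)

lemma IsRandomClosedSet.measurableSet_inter_isOpen_nonempty (hX : IsRandomClosedSet X)
    {U : Set Plane} (hU : IsOpen U) : MeasurableSet {ω | (X ω ∩ U).Nonempty} := by
  obtain ⟨F, hF, -, hFU, -⟩ := hU.exists_iUnion_isClosed
  -- An open set is a countable union of closed sets; cutting these by balls makes the pieces
  -- compact.
  have h : U = ⋃ n : ℕ, F n.unpair.1 ∩ Metric.closedBall 0 n.unpair.2 := by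
    rw [Set.iUnion_unpair (fun i j : ℕ => F i ∩ Metric.closedBall (0 : Plane) j)]
    simp only [← Set.inter_iUnion, Metric.iUnion_closedBall_nat, Set.inter_univ, hFU]
  rw [h]
  exact hX.measurableSet_inter_iUnion_nonempty fun n =>
    (isCompact_closedBall _ _).inter_left (hF _)

/-- The supremum exceeds `t` exactly when the set hits an open half-plane. Realizations that are
empty or unbounded in direction `x` form a measurable event, on which `sSup` takes its default value
`0`. -/
lemma IsRandomClosedSet.measurable_supportFun (hX : IsRandomClosedSet X) (x : Plane) :
    Measurable fun ω => supportFun (X ω) x := by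
  let M : ℝ → Set Ω := fun t => {ω | (X ω ∩ {s | t < inner ℝ x s}).Nonempty}
  have hM : ∀ t, MeasurableSet (M t) := fun t =>
    hX.measurableSet_inter_isOpen_nonempty (isOpen_lt continuous_const (by fun_prop))
  let E : Set Ω := {ω | (X ω ∩ Set.univ).Nonempty}
  have hE : MeasurableSet E := hX.measurableSet_inter_isOpen_nonempty isOpen_univ
  let B : Set Ω := ⋃ n : ℕ, (M n)ᶜ
  have hB : MeasurableSet B := MeasurableSet.iUnion fun n => (hM n).compl
  have hBiff : ∀ ω, ω ∈ B ↔ BddAbove ((fun s : Plane => inner ℝ x s) '' X ω) := by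
    intro ω
    simp only [B, M, Set.mem_iUnion, Set.mem_compl_iff, Set.mem_ofPred_eq, Set.Nonempty,
      Set.mem_inter_iff, not_exists, not_and, not_lt]
    constructor
    · rintro ⟨n, hn⟩
      exact ⟨n, by rintro _ ⟨s, hs, rfl⟩; exact hn s hs⟩
    · rintro ⟨c, hc⟩
      obtain ⟨n, hn⟩ := exists_nat_ge c
      exact ⟨n, fun s hs => (hc ⟨s, hs, rfl⟩).trans hn⟩
  refine measurable_of_Ioi fun t => ?_
  have h : (fun ω => supportFun (X ω) x) ⁻¹' Set.Ioi t =
      (B ∩ E ∩ M t) ∪ ((B ∩ E)ᶜ ∩ {_ω | t < 0}) := by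
    ext ω
    simp only [Set.mem_preimage, Set.mem_Ioi, Set.mem_union, Set.mem_inter_iff,
      Set.mem_compl_iff, Set.mem_ofPred_eq]
    by_cases hb : ω ∈ B ∧ ω ∈ E
    · simp only [hb, and_self, true_and, not_true, false_and, or_false]
      have hne : (X ω).Nonempty := by simpa [E] using hb.2
      rw [supportFun, lt_csSup_iff ((hBiff ω).1 hb.1) (hne.image _)]
      simp [M, Set.Nonempty]
    · simp only [hb, false_and, not_false_eq_true, true_and, false_or]
      have h0 : supportFun (X ω) x = 0 := by
        rw [not_and_or] at hb
        rcases hb with hb | hb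
        · exact Real.sSup_of_not_bddAbove fun h => hb ((hBiff ω).2 h)
        · have : X ω = ∅ := by
            rw [← Set.not_nonempty_iff_eq_empty]
            simpa [E] using hb
          simp [supportFun, this]
      rw [h0]
  rw [h]
  exact ((hB.inter hE).inter (hM t)).union ((hB.inter hE).compl.inter (.const _))

lemma IsRandomClosedSet.measurable_feretDiam (hX : IsRandomClosedSet X) (θ : ℝ) :
    Measurable fun ω => feretDiam (X ω) θ := by
  simp only [feretDiam, angularSupport, supportFun_neg_set]
  exact (hX.measurable_supportFun _).add (hX.measurable_supportFun _)

lemma IsRandomClosedSet.measurable_faceLengths (hX : IsRandomClosedSet X) (N : ℕ) :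
    Measurable fun ω => faceLengths N (X ω) := by
  refine measurable_pi_lambda _ fun i => ?_
  simp only [faceLengths, Matrix.mulVec, dotProduct]
  exact Finset.measurable_fun_sum _ fun _ _ => (hX.measurable_feretDiam _).const_mul _

lemma IsRandomClosedSet.zeroApprox (hX : IsRandomClosedSet X) (N : ℕ) :
    IsRandomClosedSet fun ω => zeroApprox N (X ω) where
  isClosed _ := (isCompact_regularSum N _).isClosed
  measurableSet_hits _ hK :=
    hX.measurable_faceLengths N
      (isClosed_setOf_regularSum_inter_nonempty N hK.isClosed).measurableSet

lemma IsRandomSymmetricConvex.aemeasurable_maxDiam (hX : IsRandomSymmetricConvex P X) :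
    AEMeasurable (fun ω => maxDiam (X ω)) P := by
  refine ⟨fun ω => ⨆ q : ℚ, feretDiam (X ω) q,
    .iSup fun q => hX.isRandomClosedSet.measurable_feretDiam q, ?_⟩
  filter_upwards [hX.ae_symmetricConvex] with ω hω
  exact (iSup_rat_eq_iSup hω.continuous_feretDiam).symm

/-- For convex realizations the distance is a supremum of continuous functions of the angle, so
rational angles suffice. -/
lemma IsRandomSymmetricConvex.aemeasurable_approxError (hX : IsRandomSymmetricConvex P X)
    (N : ℕ) : AEMeasurable (approxError X N) P := by
  refine ⟨fun ω => ⨆ q : ℚ, |angularSupport (X ω) q - angularSupport (zeroApprox N (X ω)) q|,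
    .iSup fun q => ((hX.isRandomClosedSet.measurable_supportFun _).sub
      ((hX.isRandomClosedSet.zeroApprox N).measurable_supportFun _)).abs, ?_⟩
  filter_upwards [hX.ae_symmetricConvex] with ω hω
  have hS : IsSymmetricConvex (FeretZonotope.zeroApprox N (X ω)) := isSymmetricConvex_regularSum N _
  rw [approxError, hausdorffDist_eq_iSup hω.isCompact hω.nonempty hω.convex hS.isCompact
    hS.nonempty hS.convex]
  exact (iSup_rat_eq_iSup ((continuous_angularSupport hω.isCompact hω.nonempty).sub
    (continuous_angularSupport hS.isCompact hS.nonempty)).abs).symm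

/-! ### Probabilistic bounds -/

lemma IsRandomSymmetricConvex.ae_approxError_le (hX : IsRandomSymmetricConvex P X) :
    ∀ᵐ ω ∂P, ∀ N : ℕ, 1 < N → approxError X N ω ≤
      (6 + 2 * √2) * Real.sin (Real.pi / (2 * N)) * maxDiam (X ω) := by
  filter_upwards [hX.ae_symmetricConvex] with ω hω N hN
  exact hω.hausdorffDist_zeroApprox_le hN

lemma sin_pi_div_two_mul_pos {N : ℕ} (hN : 1 < N) : 0 < Real.sin (Real.pi / (2 * N)) := by
  have h : (1 : ℝ) < N := by exact_mod_cast hN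
  exact Real.sin_pos_of_pos_of_lt_pi (by positivity) (div_lt_self Real.pi_pos (by linarith))

lemma IsRandomSymmetricConvex.lintegral_approxError_le (hX : IsRandomSymmetricConvex P X)
    {N : ℕ} (hN : 1 < N) :
    ∫⁻ ω, ENNReal.ofReal (approxError X N ω) ∂P ≤
      ENNReal.ofReal ((6 + 2 * √2) * Real.sin (Real.pi / (2 * N))) * expectedDiam P X := by
  have hs := sin_pi_div_two_mul_pos hN
  rw [expectedDiam, ← lintegral_const_mul' _ _ ENNReal.ofReal_ne_top]
  refine lintegral_mono_ae ?_
  filter_upwards [hX.ae_approxError_le] with ω hω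
  rw [← ENNReal.ofReal_mul (by positivity)]
  exact ENNReal.ofReal_le_ofReal (hω N hN)

lemma IsRandomSymmetricConvex.measure_lt_approxError_le (hX : IsRandomSymmetricConvex P X)
    {N : ℕ} (hN : 1 < N) {a : ℝ} (ha : 0 < a) :
    P {ω | a < approxError X N ω} ≤
      ENNReal.ofReal ((6 + 2 * √2) / a * Real.sin (Real.pi / (2 * N))) * expectedDiam P X := by
  have h1 := mul_meas_ge_le_lintegral₀ (hX.aemeasurable_approxError N).ennreal_ofReal
    (ENNReal.ofReal a)
  have h2 : P {ω | a < approxError X N ω} ≤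
      P {ω | ENNReal.ofReal a ≤ ENNReal.ofReal (approxError X N ω)} :=
    measure_mono fun ω hω => ENNReal.ofReal_le_ofReal (le_of_lt hω)
  have h3 := h1.trans (hX.lintegral_approxError_le hN)
  have hs := sin_pi_div_two_mul_pos hN
  rw [mul_comm, ← ENNReal.le_div_iff_mul_le (by simp [ha]) (by simp)] at h3
  refine h2.trans (h3.trans (le_of_eq ?_))
  rw [div_mul_eq_mul_div, ENNReal.ofReal_div_of_pos ha, ENNReal.mul_div_right_comm]

/-- Markov's inequality at the level `b`, chosen so that `b * e = c * s * E`. It requires `0 < b <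
∞`: if `E = 0` the error vanishes almost surely, and if `b = ∞` nothing is to be shown. The latter
covers `e = 0` with `E ≠ 0`. -/
lemma IsRandomSymmetricConvex.le_measure_approxError_le [IsProbabilityMeasure P]
    (hX : IsRandomSymmetricConvex P X) {N : ℕ} (hN : 1 < N) (ε : ℝ) :
    1 - ENNReal.ofReal ε ≤
      P {ω | ENNReal.ofReal (approxError X N ω) ≤
        ENNReal.ofReal (6 + 2 * √2) / ENNReal.ofReal ε *
          ENNReal.ofReal (Real.sin (Real.pi / (2 * N))) * expectedDiam P X} := by
  have hs := sin_pi_div_two_mul_pos hN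
  have hc : 0 < 6 + 2 * √2 := by positivity
  have hint := hX.lintegral_approxError_le hN
  rw [ENNReal.ofReal_mul hc.le] at hint
  set c := ENNReal.ofReal (6 + 2 * √2) with hcdef
  set s := ENNReal.ofReal (Real.sin (Real.pi / (2 * N))) with hsdef
  set E := expectedDiam P X with hE
  set e := ENNReal.ofReal ε with he
  set b := c / e * s * E with hb
  have hmeas := (hX.aemeasurable_approxError N).ennreal_ofReal
  have hc0 : c ≠ 0 := by simpa [hcdef] using hc
  have hs0 : s ≠ 0 := by simpa [hsdef] using hs
  have hetop : e ≠ ⊤ := ENNReal.ofReal_ne_top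
  have full : (∀ᵐ ω ∂P, ENNReal.ofReal (approxError X N ω) ≤ b) →
      1 - e ≤ P {ω | ENNReal.ofReal (approxError X N ω) ≤ b} := fun h => by
    rw [measure_congr (eventuallyEq_univ.2 h), measure_univ]
    exact tsub_le_self
  by_cases hE0 : E = 0
  · refine full ?_
    rw [hE0, mul_zero, nonpos_iff_eq_zero, lintegral_eq_zero_iff' hmeas] at hint
    filter_upwards [hint] with ω hω
    rw [hω]
    exact zero_le
  by_cases hbtop : b = ⊤
  · exact full (Eventually.of_forall fun ω => by rw [hbtop]; exact le_top)
  have he0 : e ≠ 0 := by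
    rintro h
    refine hbtop ?_
    rw [hb, h, ENNReal.div_zero hc0, ENNReal.top_mul hs0, ENNReal.top_mul hE0]
  have hb0 : b ≠ 0 :=
    mul_ne_zero (mul_ne_zero (ENNReal.div_ne_zero.2 ⟨hc0, hetop⟩) hs0) hE0
  have hbe : c * s * E = b * e := by
    rw [hb, mul_right_comm (c / e * s) E e, mul_right_comm (c / e) s e,
      ENNReal.div_mul_cancel he0 hetop]
  have h1 : P {ω | b ≤ ENNReal.ofReal (approxError X N ω)} ≤ e := by
    have h := (mul_meas_ge_le_lintegral₀ hmeas b).trans hint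
    rw [hbe] at h
    exact (ENNReal.mul_le_mul_iff_right hb0 hbtop).1 h
  rw [tsub_le_iff_right, ← measure_univ (μ := P)]
  refine (measure_mono fun ω _ => ?_).trans
    ((measure_union_le _ _).trans (add_le_add_right h1 _))
  exact le_total (ENNReal.ofReal (approxError X N ω)) b

/-- The deterministic bound gives almost sure convergence, which implies convergence in probability
even when the expected diameter is infinite and the tail bound is void. -/
lemma IsRandomSymmetricConvex.tendstoInMeasure_approxError [IsProbabilityMeasure P]
    (hX : IsRandomSymmetricConvex P X) :
    TendstoInMeasure P (approxError X) atTop (fun _ => 0) := by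
  refine tendstoInMeasure_of_tendsto_ae
    (fun N => (hX.aemeasurable_approxError N).aestronglyMeasurable) ?_
  filter_upwards [hX.ae_approxError_le] with ω hω
  have h0 : Tendsto (fun N : ℕ => Real.pi / (2 * N)) atTop (𝓝 0) :=
    tendsto_const_nhds.div_atTop (tendsto_natCast_atTop_atTop.const_mul_atTop zero_lt_two)
  have h1 := (((Real.continuous_sin.tendsto 0).comp h0).const_mul (6 + 2 * √2)).mul_const
    (maxDiam (X ω))
  rw [Real.sin_zero, mul_zero, zero_mul] at h1
  refine tendsto_of_tendsto_of_tendsto_of_le_of_le' tendsto_const_nhds h1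
    (Eventually.of_forall fun N => Metric.hausdorffDist_nonneg) ?_
  filter_upwards [eventually_gt_atTop 1] with N hN
  exact hω N hN

end Measurability

end FeretZonotope

theorem mainTheorem4 {Ω : Type*} [MeasurableSpace Ω] (P : Measure Ω) [IsProbabilityMeasure P]
    (X : Ω → Set FeretZonotope.Plane) (hX : FeretZonotope.IsRandomSymmetricConvex P X) :
    -- the approximation is a `0`-regular random zonotope, and the error and the maximal
    -- diameter are random variables
    (∀ N : ℕ, 1 < N →
      FeretZonotope.IsZeroRegularRandomZonotope P N
        (fun ω => FeretZonotope.zeroApprox N (X ω)) ∧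
      AEMeasurable (FeretZonotope.approxError X N) P) ∧
    AEMeasurable (fun ω => FeretZonotope.maxDiam (X ω)) P ∧
    -- the tail bound
    (∀ N : ℕ, 1 < N → ∀ a : ℝ, 0 < a →
      P {ω | a < FeretZonotope.approxError X N ω} ≤
        ENNReal.ofReal ((6 + 2 * √2) / a * Real.sin (Real.pi / (2 * N))) *
          FeretZonotope.expectedDiam P X) ∧
    -- the upper bound with confidence `1 - ε` (in `[0, ∞]`, so that `c / 0 = ∞` for `c > 0`)
    (∀ N : ℕ, 1 < N → ∀ ε ∈ Set.Icc (0 : ℝ) 1,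
      1 - ENNReal.ofReal ε ≤
        P {ω | ENNReal.ofReal (FeretZonotope.approxError X N ω) ≤
          ENNReal.ofReal (6 + 2 * √2) / ENNReal.ofReal ε *
            ENNReal.ofReal (Real.sin (Real.pi / (2 * N))) * FeretZonotope.expectedDiam P X}) ∧
    -- consistency in probability
    TendstoInMeasure P (FeretZonotope.approxError X) atTop (fun _ => 0) :=
  ⟨fun N hN => ⟨⟨hX.isRandomClosedSet.zeroApprox N,
      hX.ae_symmetricConvex.mono fun _ hω => hω.zeroApprox_mem hN⟩,
      hX.aemeasurable_approxError N⟩,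
    hX.aemeasurable_maxDiam,
    fun _ hN _ ha => hX.measure_lt_approxError_le hN ha,
    fun _ hN ε _ => hX.le_measure_approxError_le hN ε,
    hX.tendstoInMeasure_approxError⟩
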